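/- Let $S$ be a measurable space such that the diagonal of $S\times S$ is measurable in $S \times S$ (product $\sigma$-algebra), and let $(X_n)_{n\ge0}$ be a (generally non-homogeneous) Markov chain on $S$ with one-step transition kernels $\mathbb P_{t,x}(t+1,dy)$, $t=0,1,2,\dots$. For a probability measure $\mu$ on $S$ let $\mathbb P_\mu(n,\cdot)$ be the law of $X_n$ when $X_0$ has law $\mu$, and let $\|\cdot\|_{TV}$ be the total variation norm. For $x=(x^1,x^2)\in S^2=S\times S$ put $$\kappa_t(x)=\int\Big(\frac{\mathbb P_{t,x^2}(t+1,dy)}{\mathbb P_{t,x^1}(t+1,dy)}\wedge 1\Big)\mathbb P_{t,x^1}(t+1,dy),$$ where the quotient is the density of the absolutely continuous component. Let $\Lambda=\frac12(\mathbb P_{t,x^1}(t+1,\cdot)+\mathbb P_{t,x^2}(t+1,\cdot))$, let $p_1,p_2$ be the densities of $\mathbb P_{t,x^1}(t+1,\cdot)$ and $\mathbb P_{t,x^2}(t+1,\cdot)$ with respect to $\Lambda$, and let $\varphi_{t,i}(x,\cdot)$, $i=1,2$, be the probability measure $(1-\kappa_t(x))^{-1}(p_i-p_1\wedge p_2)\,d\Lambda$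 if $\kappa_t(x)<1$, and $\mathbb P_{t,x^1}(t+1,\cdot)$ if $\kappa_t(x)=1$. Assume that $\kappa_t$ and $\varphi_{t,1},\varphi_{t,2}$ depend measurably on $x\in S^2$ (this is automatic if the $\sigma$-algebra of $S$ is countably generated). Let $\eta_n=(\eta^1_n,\eta^2_n)$ be the Markov process on $S^2$ with transition kernel $\varphi_{t,1}(x,dy^1)\varphi_{t,2}(x,dy^2)$ from time $t$ to time $t+1$, and let $\mathbb E_{0,x}$ be the expectation for $\eta_0=x$. For $T\ge1$ let $\hat V^{(T)}$ be the operator on the Banach space of bounded measurable functions $h$ on $\hat S^2=\{x\in S^2: x^1\ne x^2\}$ (with the sup-norm) given by $$\hat V^{(T)}h(x)=\mathbb E_{0,x}\Big[\Big(\prod_{i=0}^{T-1}(1-\kappa_i(\eta_i))\Big)h(\eta_T)\Big],$$ where $h$ is read as $0$ on the diagonal, and let $r(\hat V^{(T)})$ be its spectral radius (that of the operator on complex-valued functions). Theorem. Suppose that, for some integer $T\ge1$, $\mathbb P_{t+T,x}(t+T+1,dy)=\mathbb P_{t,x}(t+1,dy)$ for all $t\ge0$ and $x\in S$. Then, with $\ln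 0=-\infty$, for all probability measures $\mu^1,\mu^2$ on $S$, $$\limsup_{n\to\infty}\frac1n\ln\|\mathbb P_{\mu^1}(n,\cdot)-\mathbb P_{\mu^2}(n,\cdot)\|_{TV}\le\limsup_{n\to\infty}\frac1n\ln\int(\hat V^{(T)})^{[n/T]}\mathbf 1(x^1,x^2)\,1(x^1\ne x^2)\,\mu^1(dx^1)\mu^2(dx^2)\le\frac1T\ln r(\hat V^{(T)}).$$ The bounds are uniform in the initial laws: both inequalities remain true when, before taking $\limsup_{n\to\infty}$, the first and the second expressions are replaced by their suprema over all probability measures $\mu^1,\mu^2$ on $S$. -/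

import Mathlib

open MeasureTheory ProbabilityTheory Filter Finset
open scoped ENNReal

namespace MarkovCoupling

noncomputable section

/-! ### One-step coupling of two probability measures -/

section OneStep

variable {S : Type*} [MeasurableSpace S]

/-- The overlap `∫ (dν/dμ ∧ 1) dμ`, where `dν/dμ` is the density of the absolutely continuous
component of `ν` with respect to `μ`. -/
def overlap (μ ν : Measure S) : ℝ≥0∞ := ∫⁻ y, min (ν.rnDeriv μ y) 1 ∂μ

/-- The reference measure `Λ = (μ + ν) / 2`. -/
def mid (μ ν : Measure S) : Measure S := (2⁻¹ : ℝ≥0∞) • (μ + ν)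

/-- The density of `μ` with respect to `Λ = (μ + ν) / 2`. -/
def dens₁ (μ ν : Measure S) : S → ℝ≥0∞ := μ.rnDeriv (mid μ ν)

/-- The density of `ν` with respect to `Λ = (μ + ν) / 2`. -/
def dens₂ (μ ν : Measure S) : S → ℝ≥0∞ := ν.rnDeriv (mid μ ν)

open Classical in
/-- The law `(p₁ - p₁ ∧ p₂) dΛ / (1 - κ)`; it is `μ` if `κ = 1`. -/
def residual₁ (μ ν : Measure S) : Measure S :=
  if overlap μ ν = 1 then μ else
    (mid μ ν).withDensity fun u ↦
      (dens₁ μ ν u - min (dens₁ μ ν u) (dens₂ μ ν u)) / (1 - overlap μ ν)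

open Classical in
/-- The law `(p₂ - p₁ ∧ p₂) dΛ / (1 - κ)`; it is `μ` if `κ = 1`. -/
def residual₂ (μ ν : Measure S) : Measure S :=
  if overlap μ ν = 1 then μ else
    (mid μ ν).withDensity fun u ↦
      (dens₂ μ ν u - min (dens₁ μ ν u) (dens₂ μ ν u)) / (1 - overlap μ ν)

instance (μ ν : Measure S) [IsProbabilityMeasure μ] [IsProbabilityMeasure ν] :
    IsProbabilityMeasure (mid μ ν) := by
  constructor
  simp only [mid, Measure.smul_apply, Measure.add_apply, measure_univ, smul_eq_mul]
  rw [one_add_one_eq_two]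
  exact ENNReal.inv_mul_cancel (by simp) (by simp)

lemma absolutelyContinuous_mid_left (μ ν : Measure S) : μ ≪ mid μ ν := by
  intro s hs
  simp only [mid, Measure.smul_apply, Measure.add_apply, smul_eq_mul, mul_eq_zero,
    ENNReal.inv_eq_zero, ENNReal.ofNat_ne_top, false_or, add_eq_zero] at hs
  exact hs.1

lemma absolutelyContinuous_mid_right (μ ν : Measure S) : ν ≪ mid μ ν := by
  intro s hs
  simp only [mid, Measure.smul_apply, Measure.add_apply, smul_eq_mul, mul_eq_zero,
    ENNReal.inv_eq_zero, ENNReal.ofNat_ne_top, false_or, add_eq_zero] at hs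
  exact hs.2

lemma measurable_dens₁ (μ ν : Measure S) : Measurable (dens₁ μ ν) := Measure.measurable_rnDeriv _ _

lemma measurable_dens₂ (μ ν : Measure S) : Measurable (dens₂ μ ν) := Measure.measurable_rnDeriv _ _

/-- The overlap is `∫ (p₁ ∧ p₂) dΛ`. -/
lemma overlap_eq (μ ν : Measure S) [IsProbabilityMeasure μ] [IsProbabilityMeasure ν] :
    overlap μ ν = ∫⁻ u, min (dens₁ μ ν u) (dens₂ μ ν u) ∂(mid μ ν) := by
  have hac := absolutelyContinuous_mid_left μ ν
  have h1 := Measure.rnDeriv_mul_rnDeriv' (μ := ν) hac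
  rw [overlap, ← lintegral_rnDeriv_mul hac
    (((Measure.measurable_rnDeriv ν μ).min measurable_const).aemeasurable)]
  have h2 : ∀ᵐ u ∂(mid μ ν), dens₁ μ ν u ≠ 0 → (ν.rnDeriv μ * dens₁ μ ν) u = dens₂ μ ν u := by
    have h3 : ∀ᵐ u ∂(mid μ ν).withDensity (dens₁ μ ν),
        (ν.rnDeriv μ * dens₁ μ ν) u = dens₂ μ ν u := by
      rw [dens₁, Measure.withDensity_rnDeriv_eq _ _ hac]
      exact h1
    exact (ae_withDensity_iff (measurable_dens₁ μ ν)).1 h3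
  refine lintegral_congr_ae ?_
  filter_upwards [h2] with u hu
  change dens₁ μ ν u * _ = _
  by_cases h0 : dens₁ μ ν u = 0
  · simp [h0]
  · rw [← hu h0, mul_min, mul_one, min_comm, Pi.mul_apply, mul_comm (ν.rnDeriv μ u)]

lemma overlap_le_one (μ ν : Measure S) [IsProbabilityMeasure μ] : overlap μ ν ≤ 1 := by
  calc overlap μ ν ≤ ∫⁻ _, 1 ∂μ := lintegral_mono fun _ ↦ min_le_right _ _
    _ = 1 := by simp

lemma mass_aux (μ ν : Measure S) [IsProbabilityMeasure μ] [IsProbabilityMeasure ν]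
    (f : S → ℝ≥0∞) (hf : ∫⁻ u, f u ∂(mid μ ν) = 1) (hk : overlap μ ν ≠ 1)
    (hle : ∀ u, min (dens₁ μ ν u) (dens₂ μ ν u) ≤ f u) :
    ∫⁻ u, (f u - min (dens₁ μ ν u) (dens₂ μ ν u)) / (1 - overlap μ ν) ∂(mid μ ν) = 1 := by
  have hlt : overlap μ ν < 1 := lt_of_le_of_ne (overlap_le_one μ ν) hk
  have hm : Measurable fun u ↦ min (dens₁ μ ν u) (dens₂ μ ν u) :=
    (measurable_dens₁ μ ν).min (measurable_dens₂ μ ν)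
  have hne : (1 - overlap μ ν) ≠ 0 := (tsub_pos_of_lt hlt).ne'
  simp_rw [div_eq_mul_inv]
  rw [lintegral_mul_const' _ _ (ENNReal.inv_ne_top.2 hne),
    lintegral_sub hm (by rw [← overlap_eq]; exact hlt.ne_top)
      (ae_of_all _ hle), hf, ← overlap_eq]
  exact ENNReal.mul_inv_cancel hne (by finiteness)

instance (μ ν : Measure S) [IsProbabilityMeasure μ] [IsProbabilityMeasure ν] :
    IsProbabilityMeasure (residual₁ μ ν) := by
  unfold residual₁
  split_ifs with h
  · infer_instance
  · constructor
    rw [withDensity_apply _ MeasurableSet.univ, setLIntegral_univ]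
    refine mass_aux μ ν _ ?_ h fun u ↦ min_le_left _ _
    rw [dens₁, Measure.lintegral_rnDeriv (absolutelyContinuous_mid_left μ ν), measure_univ]

instance (μ ν : Measure S) [IsProbabilityMeasure μ] [IsProbabilityMeasure ν] :
    IsProbabilityMeasure (residual₂ μ ν) := by
  unfold residual₂
  split_ifs with h
  · infer_instance
  · constructor
    rw [withDensity_apply _ MeasurableSet.univ, setLIntegral_univ]
    refine mass_aux μ ν _ ?_ h fun u ↦ min_le_right _ _
    rw [dens₂, Measure.lintegral_rnDeriv (absolutelyContinuous_mid_right μ ν), measure_univ]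

end OneStep

/-! ### The chain and the process coupled until it meets -/

section Chain

variable {S : Type*} [MeasurableSpace S]

/-- The law at time `n` of the chain with one-step transition kernels `P t` (from time `t` to time
`t + 1`) and initial law `μ`. -/
def law (P : ℕ → Kernel S S) (μ : Measure S) : ℕ → Measure S
  | 0 => μ
  | n + 1 => (law P μ n).bind (P n)

instance (P : ℕ → Kernel S S) [∀ t, IsMarkovKernel (P t)] (μ : Measure S)
    [IsProbabilityMeasure μ] (n : ℕ) : IsProbabilityMeasure (law P μ n) := by
  induction n with
  | zero => simpa [law]
  | succ n ih => simp only [law]; infer_instance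

/-- The total variation norm `‖μ - ν‖` (twice the supremum of `|μ A - ν A|` for probability
measures). -/
def tvDist (μ ν : Measure S) [IsFiniteMeasure μ] [IsFiniteMeasure ν] : ℝ≥0∞ :=
  (μ.toSignedMeasure - ν.toSignedMeasure).totalVariation Set.univ

/-- The local Markov--Dobrushin coefficient `κ_t(x¹, x²)`. -/
def kappa (P : ℕ → Kernel S S) (t : ℕ) (x : S × S) : ℝ≥0∞ := overlap (P t x.1) (P t x.2)

/-- The transition laws `φ_{t,1}` and `φ_{t,2}` and the coefficient `κ_t` depend measurably on the
pair `(x¹, x²)`, so that they define transition kernels and operators on measurable functions.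
This is automatic if the σ-algebra of `S` is countably generated, see
`measurableCoupling_of_countablyGenerated`. -/
structure MeasurableCoupling (P : ℕ → Kernel S S) : Prop where
  kappa : ∀ t, Measurable (kappa P t)
  residual₁ : ∀ t, Measurable fun x : S × S ↦ residual₁ (P t x.1) (P t x.2)
  residual₂ : ∀ t, Measurable fun x : S × S ↦ residual₂ (P t x.1) (P t x.2)

/-- On a countably generated measurable space the measurability in the pair is automatic. -/
lemma measurableCoupling_of_countablyGenerated [MeasurableSpace.CountablyGenerated S]
    (P : ℕ → Kernel S S) [∀ t, IsMarkovKernel (P t)] : MeasurableCoupling P := by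
  -- jointly measurable versions of the densities
  let K₁ : ℕ → Kernel (S × S) S := fun t ↦ (P t).comap Prod.fst measurable_fst
  let K₂ : ℕ → Kernel (S × S) S := fun t ↦ (P t).comap Prod.snd measurable_snd
  have hm : ∀ t, Measurable fun x : S × S ↦ mid (P t x.1) (P t x.2) := fun t ↦ by
    refine Measure.measurable_of_measurable_coe _ fun s hs ↦ ?_
    simp only [mid, Measure.smul_apply, Measure.add_apply, smul_eq_mul]
    exact ((((P t).measurable_coe hs).comp measurable_fst).add
      (((P t).measurable_coe hs).comp measurable_snd)).const_mul _
  let L : ℕ → Kernel (S × S) S := fun t ↦ ⟨_, hm t⟩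
  have hL : ∀ t, IsMarkovKernel (L t) := fun t ↦
    ⟨fun x ↦ inferInstanceAs (IsProbabilityMeasure (mid (P t x.1) (P t x.2)))⟩
  have e₁ : ∀ t x, Kernel.rnDeriv (K₁ t) (L t) x =ᵐ[mid (P t x.1) (P t x.2)]
      dens₁ (P t x.1) (P t x.2) := fun t x ↦ Kernel.rnDeriv_eq_rnDeriv_measure
  have e₂ : ∀ t x, Kernel.rnDeriv (K₂ t) (L t) x =ᵐ[mid (P t x.1) (P t x.2)]
      dens₂ (P t x.1) (P t x.2) := fun t x ↦ Kernel.rnDeriv_eq_rnDeriv_measure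
  have m₁ : ∀ t, Measurable fun p : (S × S) × S ↦ Kernel.rnDeriv (K₁ t) (L t) p.1 p.2 :=
    fun t ↦ Kernel.measurable_rnDeriv _ _
  have m₂ : ∀ t, Measurable fun p : (S × S) × S ↦ Kernel.rnDeriv (K₂ t) (L t) p.1 p.2 :=
    fun t ↦ Kernel.measurable_rnDeriv _ _
  have hk : ∀ t, Measurable (kappa P t) := fun t ↦ by
    have : kappa P t = fun x ↦ ∫⁻ u, min (Kernel.rnDeriv (K₁ t) (L t) x u)
        (Kernel.rnDeriv (K₂ t) (L t) x u) ∂(L t x) := by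
      ext x
      rw [kappa, overlap_eq]
      refine lintegral_congr_ae ?_
      filter_upwards [e₁ t x, e₂ t x] with u h1 h2
      rw [h1, h2]
    rw [this]
    exact Measurable.lintegral_kernel_prod_right ((m₁ t).min (m₂ t))
  have hs : ∀ t, MeasurableSet {x : S × S | overlap (P t x.1) (P t x.2) = 1} := fun t ↦
    hk t (measurableSet_singleton 1)
  have hP₁ : ∀ t, Measurable fun x : S × S ↦ P t x.1 := fun t ↦ (P t).measurable.comp measurable_fst
  refine ⟨hk, fun t ↦ ?_, fun t ↦ ?_⟩
  · refine Measurable.ite (hs t) (hP₁ t) ?_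
    let D : S × S → S → ℝ≥0∞ := fun x u ↦ (Kernel.rnDeriv (K₁ t) (L t) x u -
      min (Kernel.rnDeriv (K₁ t) (L t) x u) (Kernel.rnDeriv (K₂ t) (L t) x u)) / (1 - kappa P t x)
    have hD : Measurable (Function.uncurry D) :=
      ((m₁ t).sub ((m₁ t).min (m₂ t))).div (measurable_const.sub ((hk t).comp measurable_fst))
    convert! (Kernel.withDensity (L t) D).measurable using 1
    ext1 x
    rw [Kernel.withDensity_apply _ hD]
    refine withDensity_congr_ae ?_
    filter_upwards [e₁ t x, e₂ t x] with u h1 h2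
    simp only [D, h1, h2]
    rfl
  · refine Measurable.ite (hs t) (hP₁ t) ?_
    let D : S × S → S → ℝ≥0∞ := fun x u ↦ (Kernel.rnDeriv (K₂ t) (L t) x u -
      min (Kernel.rnDeriv (K₁ t) (L t) x u) (Kernel.rnDeriv (K₂ t) (L t) x u)) / (1 - kappa P t x)
    have hD : Measurable (Function.uncurry D) :=
      ((m₂ t).sub ((m₁ t).min (m₂ t))).div (measurable_const.sub ((hk t).comp measurable_fst))
    convert! (Kernel.withDensity (L t) D).measurable using 1
    ext1 x
    rw [Kernel.withDensity_apply _ hD]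
    refine withDensity_congr_ae ?_
    filter_upwards [e₁ t x, e₂ t x] with u h1 h2
    simp only [D, h1, h2]
    rfl

variable (P : ℕ → Kernel S S) [∀ t, IsMarkovKernel (P t)]

/-- The transition kernel of `(η¹, η²)` from time `t` to `t + 1`: given `(x¹, x²)`, the two
components are drawn independently from `φ_{t,1}` and `φ_{t,2}`. -/
def etaKernel (hP : MeasurableCoupling P) (t : ℕ) : Kernel (S × S) (S × S) :=
  Kernel.prod ⟨_, hP.residual₁ t⟩ ⟨_, hP.residual₂ t⟩

instance (hP : MeasurableCoupling P) (t : ℕ) : IsMarkovKernel (etaKernel P hP t) := by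
  have h1 : IsMarkovKernel (⟨_, hP.residual₁ t⟩ : Kernel (S × S) S) :=
    ⟨fun x ↦ inferInstanceAs (IsProbabilityMeasure (residual₁ (P t x.1) (P t x.2)))⟩
  have h2 : IsMarkovKernel (⟨_, hP.residual₂ t⟩ : Kernel (S × S) S) :=
    ⟨fun x ↦ inferInstanceAs (IsProbabilityMeasure (residual₂ (P t x.1) (P t x.2)))⟩
  unfold etaKernel
  infer_instance

/-- The law, on the space of trajectories, of the Markov process `(η¹_n, η²_n)_{n ≥ 0}` with
transition kernels `etaKernel` started at time `0` from a given pair. -/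
def etaLaw (hP : MeasurableCoupling P) : Kernel (S × S) (ℕ → S × S) :=
  (Kernel.traj (X := fun _ ↦ S × S)
    (fun n ↦ (etaKernel P hP n).comap (fun h : (i : Iic n) → S × S ↦ h ⟨n, by simp⟩)
      (measurable_pi_apply _)) 0).comap (fun x _ ↦ x) (by fun_prop)

instance (hP : MeasurableCoupling P) : IsMarkovKernel (etaLaw P hP) := by
  unfold etaLaw; infer_instance

end Chain

/-! ### Bounded measurable functions and the operator -/

section Operator

/-- The off-diagonal part of `S × S`. -/
abbrev OffDiag (S : Type*) : Type _ := {x : S × S // x.1 ≠ x.2}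

/-- The Banach space of bounded measurable functions `Ω → 𝕜` with the supremum norm
(for `𝕜 = ℝ, ℂ` strongly measurable is the same as Borel measurable). -/
def BddMeas (Ω : Type*) [MeasurableSpace Ω] (𝕜 : Type*) [RCLike 𝕜] :
    Submodule 𝕜 (lp (fun _ : Ω ↦ 𝕜) ∞) where
  carrier := {f | StronglyMeasurable fun x ↦ f x}
  add_mem' hf hg := StronglyMeasurable.add hf hg
  zero_mem' := by
    simpa using! (stronglyMeasurable_const : StronglyMeasurable fun _ : Ω ↦ (0 : 𝕜))
  smul_mem' c _ hf := StronglyMeasurable.const_smul hf c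

variable {S : Type*} [MeasurableSpace S] {𝕜 : Type*} [RCLike 𝕜]

/-- The constant function `1`. -/
def oneFun (Ω : Type*) [MeasurableSpace Ω] (𝕜 : Type*) [RCLike 𝕜] : BddMeas Ω 𝕜 :=
  ⟨⟨fun _ ↦ 1, memℓp_infty ⟨1, by rintro _ ⟨x, rfl⟩; simp⟩⟩, stronglyMeasurable_const⟩

open Classical in
/-- A function `h` on the off-diagonal set, read as `h(x) 1(x¹ ≠ x²)` on `S × S`. -/
def extZero (h : BddMeas (OffDiag S) 𝕜) (x : S × S) : 𝕜 :=
  if hx : x.1 ≠ x.2 then (h : lp (fun _ : OffDiag S ↦ 𝕜) ∞) ⟨x, hx⟩ else 0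

lemma norm_extZero_le (h : BddMeas (OffDiag S) 𝕜) (x : S × S) : ‖extZero h x‖ ≤ ‖h‖ := by
  unfold extZero
  split_ifs with hx
  · exact lp.norm_apply_le_norm (by simp) (h : lp (fun _ : OffDiag S ↦ 𝕜) ∞) ⟨x, hx⟩
  · simp

lemma extZero_add (g h : BddMeas (OffDiag S) 𝕜) (x : S × S) :
    extZero (g + h) x = extZero g x + extZero h x := by
  unfold extZero; split_ifs <;> simp

lemma extZero_smul (c : 𝕜) (h : BddMeas (OffDiag S) 𝕜) (x : S × S) :
    extZero (c • h) x = c * extZero h x := by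
  unfold extZero; split_ifs <;> simp

lemma stronglyMeasurable_extZero [MeasurableEq S] (h : BddMeas (OffDiag S) 𝕜) :
    StronglyMeasurable (extZero h) := by
  classical
  have hs : MeasurableSet {x : S × S | x.1 ≠ x.2} := measurableSet_diagonal.compl
  exact StronglyMeasurable.dite (s := {x : S × S | x.1 ≠ x.2})
    (f := fun x ↦ (h : lp (fun _ : OffDiag S ↦ 𝕜) ∞) x) (g := fun _ ↦ 0) h.2
    stronglyMeasurable_const hs

variable (P : ℕ → Kernel S S)

/-- The weight `∏_{i < T} (1 - κ_i(ω_i))` of a trajectory. -/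
def weight (T : ℕ) (ω : ℕ → S × S) : ℝ := ∏ i ∈ range T, (1 - kappa P i (ω i)).toReal

lemma weight_mem (T : ℕ) (ω : ℕ → S × S) : 0 ≤ weight P T ω ∧ weight P T ω ≤ 1 := by
  refine ⟨prod_nonneg fun _ _ ↦ ENNReal.toReal_nonneg, prod_le_one
    (fun _ _ ↦ ENNReal.toReal_nonneg) fun i _ ↦ ?_⟩
  exact ENNReal.toReal_le_of_le_ofReal zero_le_one (by simp)

variable {P} in
lemma measurable_weight (hP : MeasurableCoupling P) (T : ℕ) : Measurable (weight P T) := by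
  unfold weight
  refine Finset.measurable_fun_prod _ fun i _ ↦ ?_
  exact (measurable_const.sub ((hP.kappa i).comp (measurable_pi_apply i))).ennreal_toReal

/-- The integrand `(∏_{i < T} (1 - κ_i(ω_i))) h(ω_T)`. -/
def integrand (T : ℕ) (h : BddMeas (OffDiag S) 𝕜) (ω : ℕ → S × S) : 𝕜 :=
  (weight P T ω : 𝕜) * extZero h (ω T)

lemma norm_integrand_le (T : ℕ) (h : BddMeas (OffDiag S) 𝕜) (ω : ℕ → S × S) :
    ‖integrand P T h ω‖ ≤ ‖h‖ := by
  obtain ⟨h0, h1⟩ := weight_mem P T ω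
  rw [integrand, norm_mul, RCLike.norm_ofReal, abs_of_nonneg h0]
  calc weight P T ω * ‖extZero h (ω T)‖ ≤ 1 * ‖h‖ :=
        mul_le_mul h1 (norm_extZero_le h _) (norm_nonneg _) zero_le_one
    _ = ‖h‖ := one_mul _

variable {P} in
lemma stronglyMeasurable_integrand [MeasurableEq S] (hP : MeasurableCoupling P) (T : ℕ)
    (h : BddMeas (OffDiag S) 𝕜) : StronglyMeasurable (integrand P T h) := by
  refine StronglyMeasurable.mul ?_ ?_
  · exact RCLike.continuous_ofReal.comp_stronglyMeasurable
      (measurable_weight hP T).stronglyMeasurable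
  · exact (stronglyMeasurable_extZero h).comp_measurable (measurable_pi_apply T)

variable [∀ t, IsMarkovKernel (P t)]

variable {P} in
lemma integrable_integrand [MeasurableEq S] (hP : MeasurableCoupling P) (T : ℕ)
    (h : BddMeas (OffDiag S) 𝕜) (x : S × S) : Integrable (integrand P T h) (etaLaw P hP x) :=
  Integrable.of_bound (stronglyMeasurable_integrand hP T h).aestronglyMeasurable ‖h‖
    (ae_of_all _ (norm_integrand_le P T h))

variable {P} in
lemma norm_integral_integrand_le (hP : MeasurableCoupling P) (T : ℕ)
    (h : BddMeas (OffDiag S) 𝕜) (x : S × S) :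
    ‖∫ ω, integrand P T h ω ∂(etaLaw P hP x)‖ ≤ ‖h‖ := by
  simpa using norm_integral_le_of_norm_le_const (μ := etaLaw P hP x)
    (ae_of_all _ (norm_integrand_le P T h))

/-- The operator `V̂^{(T)} h(x) = E_{0,x} [(∏_{i < T} (1 - κ_i(η_i))) h(η_T)]` on the bounded
measurable functions on the off-diagonal part of `S × S`. -/
def VhatT (𝕜 : Type*) [RCLike 𝕜] [MeasurableEq S] (hP : MeasurableCoupling P) (T : ℕ) :
    BddMeas (OffDiag S) 𝕜 →L[𝕜] BddMeas (OffDiag S) 𝕜 :=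
  LinearMap.mkContinuous
    { toFun := fun h ↦
        ⟨⟨fun x ↦ ∫ ω, integrand P T h ω ∂(etaLaw P hP x.1), memℓp_infty
            ⟨‖h‖, by rintro _ ⟨x, rfl⟩; exact norm_integral_integrand_le hP T h x.1⟩⟩,
          (stronglyMeasurable_integrand hP T h).integral_kernel.comp_measurable
            measurable_subtype_coe⟩
      map_add' := fun g h ↦ by
        ext x
        simp only [Submodule.coe_add, lp.coeFn_add, Pi.add_apply]
        rw [← integral_add (integrable_integrand hP T g _) (integrable_integrand hP T h _)]
        simp [integrand, extZero_add, mul_add]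
      map_smul' := fun c h ↦ by
        ext x
        simp only [Submodule.coe_smul, lp.coeFn_smul, Pi.smul_apply, RingHom.id_apply,
          smul_eq_mul]
        rw [← integral_const_mul]
        simp [integrand, extZero_smul, mul_left_comm] }
    1 fun h ↦ by
      rw [one_mul]
      refine lp.norm_le_of_forall_le (norm_nonneg _) fun x ↦ ?_
      exact norm_integral_integrand_le hP T h x.1

end Operator

/-! ### Exponential rates -/

section Rates

variable {S : Type*} [MeasurableSpace S]

/-- `(1/n) ln ‖P_{μ¹}(n, ·) - P_{μ²}(n, ·)‖_TV`, with `ln 0 = -∞`. -/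
def tvRate (P : ℕ → Kernel S S) [∀ t, IsMarkovKernel (P t)] (μ₁ μ₂ : ProbabilityMeasure S)
    (n : ℕ) : EReal :=
  ENNReal.log (tvDist (law P μ₁ n) (law P μ₂ n)) / n

/-- `(1/n) ln ∫ (V̂^{(T)})^{[n/T]} 1 (x¹, x²) 1(x¹ ≠ x²) μ¹(dx¹) μ²(dx²)`, with `ln 0 = -∞`. -/
def couplingRate [MeasurableEq S] (P : ℕ → Kernel S S) [∀ t, IsMarkovKernel (P t)]
    (hP : MeasurableCoupling P) (T : ℕ) (μ₁ μ₂ : ProbabilityMeasure S) (n : ℕ) : EReal :=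
  ENNReal.log (ENNReal.ofReal
    (∫ x, extZero ((VhatT P ℝ hP T ^ (n / T)) (oneFun (OffDiag S) ℝ)) x
      ∂((μ₁ : Measure S).prod (μ₂ : Measure S)))) / n

end Rates

end

end MarkovCoupling

namespace MarkovCoupling

noncomputable section

/-! ### The residual decomposition -/

section OneStepDecomposition

variable {S : Type*} [MeasurableSpace S]

/-! Two laws μ, ν share a common part of mass κ, and what remains is 1 - κ times the residual laws
φ₁, φ₂ (`common_add_residual₁`, `common_add_residual₂`). Integrals against μ and ν thus differ only
through the residuals, which gives the one-step estimate `lintegral_le_add_residual`. Write V_t h(x)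
= (1 - κ_t(x)) E[h(η_{t+1}) | η_t = x], which is `stepOp`. Iterating the estimate, for 0 ≤ f ≤ 1 the
m-step backward evolutions of f from x¹ and x² at time s differ by at most V_s ⋯ V_{s+m-1} 1_{x¹ ≠
x²}(x) (`backward_le_add_iterOp`); no coupled chain has to be constructed. Indicators f, integrated
over μ¹ ⊗ μ², bound the total variation norm up to a factor 2 (`tvDist_law_le`).

The Markov property of η identifies V̂^{(T)} with V_0 ⋯ V_{T-1} (`lintegral_eweight_mul`), and
periodicity turns its k-th power into the product over kT steps (`ofReal_extZero_VhatT_pow`). The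
remaining n mod T steps can only decrease the bound, and the factor 2 costs ln 2 / n, which vanishes
in the limit. The second inequality is the upper half of Gelfand's formula together with [n/T]/n →
1/T (`limsup_log_nnnorm_pow_div_le`). Both comparisons are made at fixed n with errors independent
of the initial laws, so they survive suprema. -/

lemma overlap_self (μ : Measure S) [IsProbabilityMeasure μ] : overlap μ μ = 1 := by
  rw [overlap, lintegral_congr_ae (g := fun _ ↦ 1)]
  · simp
  · filter_upwards [Measure.rnDeriv_self μ] with y hy
    simp [hy]

/-- The common part `(p₁ ∧ p₂) dΛ` of two measures. -/
def common (μ ν : Measure S) : Measure S :=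
  (mid μ ν).withDensity fun u ↦ min (dens₁ μ ν u) (dens₂ μ ν u)

variable (μ ν : Measure S)

lemma common_univ [IsProbabilityMeasure μ] [IsProbabilityMeasure ν] :
    common μ ν Set.univ = overlap μ ν := by
  rw [common, withDensity_apply _ MeasurableSet.univ, setLIntegral_univ, overlap_eq]

lemma common_add_withDensity_sub (f : S → ℝ≥0∞)
    (hle : ∀ u, min (dens₁ μ ν u) (dens₂ μ ν u) ≤ f u) :
    common μ ν + (mid μ ν).withDensity (fun u ↦ f u - min (dens₁ μ ν u) (dens₂ μ ν u)) =
      (mid μ ν).withDensity f := by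
  have hm : Measurable fun u ↦ min (dens₁ μ ν u) (dens₂ μ ν u) :=
    (measurable_dens₁ μ ν).min (measurable_dens₂ μ ν)
  rw [common, ← withDensity_add_left hm]
  congr 1
  ext u
  exact add_tsub_cancel_of_le (hle u)

lemma eq_of_le_of_univ_eq {μ ν : Measure S} [IsFiniteMeasure ν] (hle : μ ≤ ν)
    (h : μ Set.univ = ν Set.univ) : μ = ν := by
  have : IsFiniteMeasure μ := isFiniteMeasure_of_le ν hle
  refine le_antisymm hle (Measure.le_intro fun s hs _ ↦ ?_)
  by_contra hlt
  rw [not_le] at hlt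
  have := ENNReal.add_lt_add_of_lt_of_le (measure_ne_top μ _) hlt (hle sᶜ)
  rw [measure_add_measure_compl hs, measure_add_measure_compl hs, h] at this
  exact this.false

lemma smul_withDensity_div [IsProbabilityMeasure μ] (hk : overlap μ ν ≠ 1) (f : S → ℝ≥0∞) (hf : Measurable f) :
    (1 - overlap μ ν) • (mid μ ν).withDensity (fun u ↦ f u / (1 - overlap μ ν)) =
      (mid μ ν).withDensity f := by
  have hne : 1 - overlap μ ν ≠ 0 :=
    (tsub_pos_of_lt (lt_of_le_of_ne (overlap_le_one μ ν) hk)).ne'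
  rw [← withDensity_smul _ (hf.div_const _)]
  congr 1
  ext u
  exact ENNReal.mul_div_cancel hne (by finiteness)

variable [IsProbabilityMeasure μ] [IsProbabilityMeasure ν]

lemma common_add_residual₁ : common μ ν + (1 - overlap μ ν) • residual₁ μ ν = μ := by
  have h0 := common_add_withDensity_sub μ ν _ fun u ↦ min_le_left _ _
  have h1 : (mid μ ν).withDensity (dens₁ μ ν) = μ :=
    Measure.withDensity_rnDeriv_eq _ _ (absolutelyContinuous_mid_left μ ν)
  by_cases h : overlap μ ν = 1
  · rw [h, tsub_self, zero_smul, add_zero]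
    -- When κ = 1 the common part lies below μ and already has full mass, so the conventional value
    -- of the residual plays no role.
    refine eq_of_le_of_univ_eq ?_ (by rw [common_univ, h, measure_univ])
    rw [h1] at h0
    conv_rhs => rw [← h0]
    exact Measure.le_add_right le_rfl
  · rw [residual₁, if_neg h, smul_withDensity_div μ ν h _ (by
      exact (measurable_dens₁ μ ν).sub ((measurable_dens₁ μ ν).min (measurable_dens₂ μ ν))),
      h0, h1]

lemma common_add_residual₂ : common μ ν + (1 - overlap μ ν) • residual₂ μ ν = ν := by
  have h0 := common_add_withDensity_sub μ ν _ fun u ↦ min_le_right _ _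
  have h1 : (mid μ ν).withDensity (dens₂ μ ν) = ν :=
    Measure.withDensity_rnDeriv_eq _ _ (absolutelyContinuous_mid_right μ ν)
  by_cases h : overlap μ ν = 1
  · rw [h, tsub_self, zero_smul, add_zero]
    refine eq_of_le_of_univ_eq ?_ (by rw [common_univ, h, measure_univ])
    rw [h1] at h0
    conv_rhs => rw [← h0]
    exact Measure.le_add_right le_rfl
  · rw [residual₂, if_neg h, smul_withDensity_div μ ν h _ (by
      exact (measurable_dens₂ μ ν).sub ((measurable_dens₁ μ ν).min (measurable_dens₂ μ ν))),
      h0, h1]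

/-- The one-step coupling inequality. -/
lemma lintegral_le_add_residual (g : S → ℝ≥0∞) (hg : Measurable g) (w : S × S → ℝ≥0∞)
    (hw : ∀ y : S × S, g y.1 ≤ g y.2 + w y ∧ g y.2 ≤ g y.1 + w y) :
    (∫⁻ y, g y ∂μ ≤ ∫⁻ y, g y ∂ν +
      (1 - overlap μ ν) * ∫⁻ y, w y ∂((residual₁ μ ν).prod (residual₂ μ ν))) ∧
    (∫⁻ y, g y ∂ν ≤ ∫⁻ y, g y ∂μ +
      (1 - overlap μ ν) * ∫⁻ y, w y ∂((residual₁ μ ν).prod (residual₂ μ ν))) := by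
  have e1 : ∫⁻ y, g y ∂μ = ∫⁻ y, g y ∂(common μ ν) +
      (1 - overlap μ ν) * ∫⁻ y, g y ∂(residual₁ μ ν) := by
    conv_lhs => rw [← common_add_residual₁ μ ν]
    rw [lintegral_add_measure, lintegral_smul_measure, smul_eq_mul]
  have e2 : ∫⁻ y, g y ∂ν = ∫⁻ y, g y ∂(common μ ν) +
      (1 - overlap μ ν) * ∫⁻ y, g y ∂(residual₂ μ ν) := by
    conv_lhs => rw [← common_add_residual₂ μ ν]
    rw [lintegral_add_measure, lintegral_smul_measure, smul_eq_mul]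
  have f1 : ∫⁻ y : S × S, g y.1 ∂((residual₁ μ ν).prod (residual₂ μ ν)) =
      ∫⁻ y, g y ∂(residual₁ μ ν) := measurePreserving_fst.lintegral_comp hg
  have f2 : ∫⁻ y : S × S, g y.2 ∂((residual₁ μ ν).prod (residual₂ μ ν)) =
      ∫⁻ y, g y ∂(residual₂ μ ν) := measurePreserving_snd.lintegral_comp hg
  rw [e1, e2, add_assoc, add_assoc, ← mul_add, ← mul_add, ← f1, ← f2]
  constructor
  · rw [← lintegral_add_left (f := fun y : S × S ↦ g y.2) (hg.comp measurable_snd)]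
    gcongr with y
    exact (hw y).1
  · rw [← lintegral_add_left (f := fun y : S × S ↦ g y.1) (hg.comp measurable_fst)]
    gcongr with y
    exact (hw y).2

/-- The total variation norm is controlled by the values on measurable sets. -/
lemma tvDist_le {c : ℝ≥0∞} (h₁ : ∀ s, MeasurableSet s → μ s ≤ ν s + c)
    (h₂ : ∀ s, MeasurableSet s → ν s ≤ μ s + c) : tvDist μ ν ≤ 2 * c := by
  rcases eq_or_ne c ∞ with rfl | hc
  · simp
  obtain ⟨i, hi, hi0, hi1, hpos, hneg⟩ :=
    (μ.toSignedMeasure - ν.toSignedMeasure).toJordanDecomposition_spec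
  rw [tvDist, SignedMeasure.totalVariation, Measure.add_apply, hpos, hneg,
    SignedMeasure.toMeasureOfZeroLE_apply _ _ _ MeasurableSet.univ,
    SignedMeasure.toMeasureOfLEZero_apply _ _ _ MeasurableSet.univ, two_mul]
  refine add_le_add ?_ ?_
  · have := h₁ i hi
    rw [← ENNReal.coe_toNNReal hc, ENNReal.coe_le_coe, ← NNReal.coe_le_coe]
    simp only [Set.inter_univ, NNReal.coe_mk, Measure.toSignedMeasure_sub_apply hi]
    have h := ENNReal.toReal_mono (by finiteness) this
    rw [ENNReal.toReal_add (by finiteness) hc] at h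
    simp only [measureReal_def]
    change _ ≤ c.toReal
    linarith
  · have := h₂ iᶜ hi.compl
    rw [← ENNReal.coe_toNNReal hc, ENNReal.coe_le_coe, ← NNReal.coe_le_coe]
    simp only [Set.inter_univ, NNReal.coe_mk, Measure.toSignedMeasure_sub_apply hi.compl]
    have h := ENNReal.toReal_mono (by finiteness) this
    rw [ENNReal.toReal_add (by finiteness) hc] at h
    simp only [measureReal_def]
    change _ ≤ c.toReal
    linarith

end OneStepDecomposition

/-! ### Iterated one-step operators -/

section Iterates

/-- The indicator of the off-diagonal part of `S × S`. -/
def offDiagInd (S : Type*) : S × S → ℝ≥0∞ := {x : S × S | x.1 ≠ x.2}.indicator 1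

lemma offDiagInd_le_one {S : Type*} (x : S × S) : offDiagInd S x ≤ 1 :=
  Set.indicator_le (fun _ _ ↦ le_rfl) x

variable {S : Type*} [MeasurableSpace S] (P : ℕ → Kernel S S)
  (hP : MeasurableCoupling P)

lemma kappa_diag [∀ t, IsMarkovKernel (P t)] (t : ℕ) {x : S × S} (hx : x.1 = x.2) : kappa P t x = 1 := by
  rw [kappa, hx, overlap_self]

/-- The operator `h ↦ (1 - κ_t(x)) ∫ h(y) φ_{t,1}(x, dy¹) φ_{t,2}(x, dy²)`. -/
def stepOp (t : ℕ) (h : S × S → ℝ≥0∞) (x : S × S) : ℝ≥0∞ :=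
  (1 - kappa P t x) * ∫⁻ y, h y ∂(etaKernel P hP t x)

/-- The composition of the operators `stepOp` from time `s` to time `s + m`. -/
def iterOp : ℕ → ℕ → (S × S → ℝ≥0∞) → S × S → ℝ≥0∞
  | _, 0, h => h
  | s, m + 1, h => stepOp P hP s (iterOp (s + 1) m h)

variable {P}

lemma measurable_stepOp (t : ℕ) {h : S × S → ℝ≥0∞} (hh : Measurable h) :
    Measurable (stepOp P hP t h) :=
  (measurable_const.sub (hP.kappa t)).mul hh.lintegral_kernel

lemma measurable_iterOp (s m : ℕ) {h : S × S → ℝ≥0∞} (hh : Measurable h) :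
    Measurable (iterOp P hP s m h) := by
  induction m generalizing s with
  | zero => exact hh
  | succ m ih => exact measurable_stepOp hP s (ih (s + 1))

lemma stepOp_mono (t : ℕ) {g h : S × S → ℝ≥0∞} (hgh : g ≤ h) :
    stepOp P hP t g ≤ stepOp P hP t h := fun x ↦ by
  unfold stepOp
  gcongr with y
  exact hgh y

lemma iterOp_mono (s m : ℕ) {g h : S × S → ℝ≥0∞} (hgh : g ≤ h) :
    iterOp P hP s m g ≤ iterOp P hP s m h := by
  induction m generalizing s with
  | zero => exact hgh
  | succ m ih => exact stepOp_mono hP s (ih (s + 1))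

lemma iterOp_add (s m k : ℕ) (h : S × S → ℝ≥0∞) :
    iterOp P hP s (m + k) h = iterOp P hP s m (iterOp P hP (s + m) k h) := by
  induction m generalizing s with
  | zero => simp [iterOp]
  | succ m ih =>
    rw [show m + 1 + k = m + k + 1 by omega]
    simp only [iterOp]
    rw [ih (s + 1), show s + 1 + m = s + (m + 1) by omega]

/-- `iterOp` peels off the earliest step, whereas the trajectory law is extended at the latest one;
this form fits the second recursion. -/
lemma iterOp_succ_right (s m : ℕ) (h : S × S → ℝ≥0∞) :
    iterOp P hP s (m + 1) h = iterOp P hP s m (stepOp P hP (s + m) h) := by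
  rw [iterOp_add]; rfl

lemma measurable_offDiagInd [MeasurableEq S] : Measurable (offDiagInd S) :=
  measurable_one.indicator measurableSet_diagonal.compl

variable [∀ t, IsMarkovKernel (P t)]

lemma stepOp_diag (t : ℕ) (h : S × S → ℝ≥0∞) {x : S × S} (hx : x.1 = x.2) :
    stepOp P hP t h x = 0 := by
  simp [stepOp, kappa_diag P t hx]

lemma iterOp_diag (s : ℕ) {m : ℕ} (hm : 1 ≤ m) (h : S × S → ℝ≥0∞) {x : S × S} (hx : x.1 = x.2) :
    iterOp P hP s m h x = 0 := by
  obtain ⟨m, rfl⟩ := Nat.exists_eq_add_of_le' hm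
  exact stepOp_diag hP s _ hx

/-- The off-diagonal indicator is superharmonic: κ = 1 on the diagonal kills the value there, and
elsewhere both factors are at most 1. Hence additional steps only lower the iterates. -/
lemma stepOp_offDiagInd_le (t : ℕ) : stepOp P hP t (offDiagInd S) ≤ offDiagInd S := by
  intro x
  by_cases hx : x.1 = x.2
  · rw [stepOp_diag hP t _ hx]; exact zero_le
  · have : offDiagInd S x = 1 := by simp [offDiagInd, hx]
    rw [this, stepOp]
    refine mul_le_one' tsub_le_self ((lintegral_mono offDiagInd_le_one).trans ?_)
    simp

lemma iterOp_offDiagInd_le (s m : ℕ) : iterOp P hP s m (offDiagInd S) ≤ offDiagInd S := by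
  induction m generalizing s with
  | zero => exact le_rfl
  | succ m ih => exact (stepOp_mono hP s (ih (s + 1))).trans (stepOp_offDiagInd_le hP s)

lemma etaKernel_apply (t : ℕ) (x : S × S) : etaKernel P hP t x =
    (residual₁ (P t x.1) (P t x.2)).prod (residual₂ (P t x.1) (P t x.2)) := by
  have h1 : IsMarkovKernel (⟨_, hP.residual₁ t⟩ : Kernel (S × S) S) :=
    ⟨fun x ↦ inferInstanceAs (IsProbabilityMeasure (residual₁ (P t x.1) (P t x.2)))⟩
  have h2 : IsMarkovKernel (⟨_, hP.residual₂ t⟩ : Kernel (S × S) S) :=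
    ⟨fun x ↦ inferInstanceAs (IsProbabilityMeasure (residual₂ (P t x.1) (P t x.2)))⟩
  rw [etaKernel, Kernel.prod_apply]
  rfl

lemma stepOp_congr {t t' : ℕ} (h : P t = P t') : stepOp P hP t = stepOp P hP t' := by
  ext f x
  simp only [stepOp, kappa, etaKernel_apply, h]

lemma iterOp_add_period {T : ℕ} (hper : ∀ t, P (t + T) = P t) (s m : ℕ) (h : S × S → ℝ≥0∞) :
    iterOp P hP (s + T) m h = iterOp P hP s m h := by
  induction m generalizing s with
  | zero => rfl
  | succ m ih =>
    simp only [iterOp]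
    rw [stepOp_congr hP (hper s), show s + T + 1 = s + 1 + T by omega, ih]

end Iterates

/-! ### The coupling inequality -/

section Coupling

variable {S : Type*} [MeasurableSpace S] (P : ℕ → Kernel S S)

/-- The backward transition operator from time `s` to time `s + m`. -/
def backward : ℕ → ℕ → (S → ℝ≥0∞) → S → ℝ≥0∞
  | _, 0, f => f
  | s, m + 1, f => fun x ↦ ∫⁻ y, backward (s + 1) m f y ∂(P s x)

variable {P}

lemma measurable_backward (s m : ℕ) {f : S → ℝ≥0∞} (hf : Measurable f) :
    Measurable (backward P s m f) := by
  induction m generalizing s with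
  | zero => exact hf
  | succ m ih => exact (ih (s + 1)).lintegral_kernel

lemma backward_succ_right (s m : ℕ) (f : S → ℝ≥0∞) :
    backward P s (m + 1) f = backward P s m (fun x ↦ ∫⁻ y, f y ∂(P (s + m) x)) := by
  induction m generalizing s with
  | zero => rfl
  | succ m ih =>
    rw [backward, ih (s + 1), show s + 1 + m = s + (m + 1) by omega]
    rfl

lemma lintegral_law (μ : Measure S) (n : ℕ) {f : S → ℝ≥0∞} (hf : Measurable f) :
    ∫⁻ y, f y ∂(law P μ n) = ∫⁻ x, backward P 0 n f x ∂μ := by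
  induction n generalizing f with
  | zero => rfl
  | succ n ih =>
    rw [law, Measure.lintegral_bind (P n).aemeasurable hf.aemeasurable,
      ih hf.lintegral_kernel, backward_succ_right, zero_add]

variable [∀ t, IsMarkovKernel (P t)] (hP : MeasurableCoupling P)

/-- Induction on m. With no step left, values in [0, 1] differ by at most 1, and only off the
diagonal. The inductive step is the one-step inequality, with the bound for the later steps as the
cost w. -/
lemma backward_le_add_iterOp (s m : ℕ) {f : S → ℝ≥0∞} (hf : Measurable f) (hf1 : ∀ x, f x ≤ 1)
    (x : S × S) :
    backward P s m f x.1 ≤ backward P s m f x.2 + iterOp P hP s m (offDiagInd S) x ∧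
    backward P s m f x.2 ≤ backward P s m f x.1 + iterOp P hP s m (offDiagInd S) x := by
  induction m generalizing s x with
  | zero =>
    simp only [backward, iterOp]
    by_cases hx : x.1 = x.2
    · rw [hx]; exact ⟨le_self_add, le_self_add⟩
    · have : offDiagInd S x = 1 := by simp [offDiagInd, hx]
      rw [this]
      exact ⟨(hf1 _).trans le_add_self, (hf1 _).trans le_add_self⟩
  | succ m ih =>
    simp only [backward, iterOp, stepOp, etaKernel_apply]
    exact lintegral_le_add_residual _ _ _ (measurable_backward _ _ hf) _ (ih (s + 1))

lemma tvDist_law_le [MeasurableEq S] (μ₁ μ₂ : Measure S) [IsProbabilityMeasure μ₁]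
    [IsProbabilityMeasure μ₂] (n : ℕ) :
    tvDist (law P μ₁ n) (law P μ₂ n) ≤
      2 * ∫⁻ x, iterOp P hP 0 n (offDiagInd S) x ∂(μ₁.prod μ₂) := by
  have hle (x) : ∀ {s : Set S}, s.indicator (1 : S → ℝ≥0∞) x ≤ 1 :=
    fun {s} ↦ Set.indicator_le (fun _ _ ↦ le_rfl) x
  -- Both laws are written as integrals over the same product space, so that the pointwise bound can
  -- be integrated.
  have e1 {s : Set S} (hs : MeasurableSet s) : law P μ₁ n s =
      ∫⁻ x : S × S, backward P 0 n (s.indicator 1) x.1 ∂(μ₁.prod μ₂) := by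
    rw [measurePreserving_fst.lintegral_comp
      (measurable_backward 0 n (measurable_one.indicator hs)),
      ← lintegral_law _ _ (measurable_one.indicator hs), lintegral_indicator_one hs]
  have e2 {s : Set S} (hs : MeasurableSet s) : law P μ₂ n s =
      ∫⁻ x : S × S, backward P 0 n (s.indicator 1) x.2 ∂(μ₁.prod μ₂) := by
    rw [measurePreserving_snd.lintegral_comp
      (measurable_backward 0 n (measurable_one.indicator hs)),
      ← lintegral_law _ _ (measurable_one.indicator hs), lintegral_indicator_one hs]
  have hm := measurable_iterOp hP 0 n (measurable_offDiagInd (S := S))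
  refine tvDist_le _ _ (fun s hs ↦ ?_) (fun s hs ↦ ?_)
  · rw [e1 hs, e2 hs, ← lintegral_add_right _ hm]
    exact lintegral_mono fun x ↦
      (backward_le_add_iterOp hP 0 n (measurable_one.indicator hs) (fun x ↦ hle x) x).1
  · rw [e1 hs, e2 hs, ← lintegral_add_right _ hm]
    exact lintegral_mono fun x ↦
      (backward_le_add_iterOp hP 0 n (measurable_one.indicator hs) (fun x ↦ hle x) x).2

end Coupling

/-! ### The law of the trajectories -/

section Trajectory

variable {S : Type*} [MeasurableSpace S] (P : ℕ → Kernel S S)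

/-- The weight `∏_{i < T} (1 - κ_i(ω_i))` with values in `ℝ≥0∞`. -/
def eweight (T : ℕ) (ω : ℕ → S × S) : ℝ≥0∞ := ∏ i ∈ range T, (1 - kappa P i (ω i))

lemma ofReal_weight (T : ℕ) (ω : ℕ → S × S) : ENNReal.ofReal (weight P T ω) = eweight P T ω := by
  rw [weight, ENNReal.ofReal_prod_of_nonneg fun _ _ ↦ ENNReal.toReal_nonneg]
  exact prod_congr rfl fun i _ ↦ ENNReal.ofReal_toReal (by finiteness)

variable {P}

lemma measurable_eweight (hP : MeasurableCoupling P) (T : ℕ) : Measurable (eweight P T) :=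
  Finset.measurable_fun_prod _ fun i _ ↦
    measurable_const.sub ((hP.kappa i).comp (measurable_pi_apply i))

variable [∀ t, IsMarkovKernel (P t)] (hP : MeasurableCoupling P)

lemma etaLaw_apply_zero (x : S × S) : (etaLaw P hP x).map (fun ω ↦ ω 0) = Measure.dirac x := by
  have h : (fun ω : ℕ → S × S ↦ ω 0) =
      (fun u : (i : Iic 0) → S × S ↦ u ⟨0, by simp⟩) ∘ Preorder.frestrictLe 0 := rfl
  rw [h, ← Measure.map_map (by fun_prop) (by fun_prop), etaLaw, Kernel.comap_apply,
    Kernel.traj_map_frestrictLe_apply, Kernel.partialTraj_self, Kernel.id_apply]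
  exact Measure.map_dirac' (measurable_pi_apply _) _

/-- This is the Markov property at time T. The hypothesis `hdep` says that G depends only on the
path up to T: freezing the path from then on leaves G unchanged. -/
lemma lintegral_etaLaw_succ (T : ℕ) {G : (ℕ → S × S) → ℝ≥0∞} (hG : Measurable G)
    (hdep : ∀ ω, G (fun i ↦ ω (min i T)) = G ω) {h : S × S → ℝ≥0∞} (hh : Measurable h)
    (x : S × S) :
    ∫⁻ ω, G ω * h (ω (T + 1)) ∂(etaLaw P hP x) =
      ∫⁻ ω, G ω * ∫⁻ y, h y ∂(etaKernel P hP T (ω T)) ∂(etaLaw P hP x) := by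
  let κ : (n : ℕ) → Kernel ((i : Iic n) → S × S) (S × S) := fun n ↦
    (etaKernel P hP n).comap (fun h ↦ h ⟨n, by simp⟩) (measurable_pi_apply _)
  -- G as a function of the history up to T, continued by its last value.
  let G' : ((i : Iic T) → S × S) → ℝ≥0∞ := fun u ↦ G fun i ↦ u ⟨min i T, by simp⟩
  have hG' : Measurable G' := hG.comp (measurable_pi_lambda _ fun i ↦ measurable_pi_apply _)
  have hGω (ω : ℕ → S × S) : G' (Preorder.frestrictLe T ω) = G ω := hdep ω
  have hmul : Measurable fun p : ((i : Iic T) → S × S) × (S × S) ↦ G' p.1 * h p.2 :=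
    (hG'.comp measurable_fst).mul (hh.comp measurable_snd)
  have hKG : Measurable fun u ↦ G' u * ∫⁻ y, h y ∂(κ T u) := hG'.mul hh.lintegral_kernel
  have hlaw : etaLaw P hP x = Kernel.traj (X := fun _ ↦ S × S) κ 0 (fun _ ↦ x) := rfl
  have key := Kernel.partialTraj_compProd_eq_map_traj (X := fun _ ↦ S × S) (κ := κ)
    (Nat.zero_le T) (x₀ := fun _ ↦ x)
  rw [← hlaw] at key
  calc ∫⁻ ω, G ω * h (ω (T + 1)) ∂(etaLaw P hP x)
      = ∫⁻ p, G' p.1 * h p.2 ∂((etaLaw P hP x).map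
          fun ω ↦ (Preorder.frestrictLe T ω, ω (T + 1))) := by
        rw [lintegral_map hmul (by fun_prop)]
        simp only [hGω]
    _ = ∫⁻ u, G' u * ∫⁻ y, h y ∂(κ T u) ∂(Kernel.partialTraj (X := fun _ ↦ S × S) κ 0 T
          fun _ ↦ x) := by
        rw [← key, Measure.lintegral_compProd hmul]
        simp only [lintegral_const_mul _ hh]
    _ = ∫⁻ ω, G ω * ∫⁻ y, h y ∂(etaKernel P hP T (ω T)) ∂(etaLaw P hP x) := by
        rw [← Kernel.traj_map_frestrictLe_apply, ← hlaw, lintegral_map hKG (by fun_prop)]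
        simp only [hGω]
        rfl

/-- A Feynman–Kac formula: weighting paths by the product of the factors 1 - κ_i amounts to
composing the one-step operators. -/
lemma lintegral_eweight_mul (T : ℕ) {h : S × S → ℝ≥0∞} (hh : Measurable h) (x : S × S) :
    ∫⁻ ω, eweight P T ω * h (ω T) ∂(etaLaw P hP x) = iterOp P hP 0 T h x := by
  induction T generalizing h with
  | zero =>
    simp only [eweight, range_zero, prod_empty, one_mul, iterOp]
    rw [← lintegral_map hh (measurable_pi_apply 0), etaLaw_apply_zero, lintegral_dirac' _ hh]
  | succ T ih =>
    -- The weight with T + 1 factors involves only the positions at times 0, …, T. Its last factor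
    -- joins the conditional expectation of h to form `stepOp` at time T.
    rw [lintegral_etaLaw_succ hP T (measurable_eweight hP (T + 1)) _ hh, iterOp_succ_right,
      ← ih (measurable_stepOp hP _ hh)]
    · refine lintegral_congr fun ω ↦ ?_
      rw [eweight, prod_range_succ, mul_assoc, zero_add]
      rfl
    · intro ω
      refine prod_congr rfl fun i hi ↦ ?_
      have hi' : i ≤ T := Nat.lt_succ_iff.1 (mem_range.1 hi)
      simp only [min_eq_left hi']

end Trajectory

/-! ### The powers of the operator -/

section Powers

instance (Ω : Type*) [MeasurableSpace Ω] (𝕜 : Type*) [RCLike 𝕜] :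
    CompleteSpace (BddMeas Ω 𝕜) := by
  refine IsClosed.completeSpace_coe (hs := IsSeqClosed.isClosed fun f g hf hg ↦ ?_)
  change StronglyMeasurable fun x ↦ g x
  refine stronglyMeasurable_of_tendsto atTop hf (tendsto_pi_nhds.2 fun x ↦ ?_)
  rw [tendsto_iff_norm_sub_tendsto_zero] at hg ⊢
  exact squeeze_zero (fun _ ↦ norm_nonneg _)
    (fun n ↦ lp.norm_apply_le_norm (by simp) (f n - g) x) hg

lemma BddMeas.isTopologicalAddGroup (Ω : Type*) [MeasurableSpace Ω] (𝕜 : Type*) [RCLike 𝕜] :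
    IsTopologicalAddGroup (BddMeas Ω 𝕜) := SeminormedAddCommGroup.toIsTopologicalAddGroup

attribute [local instance] BddMeas.isTopologicalAddGroup

lemma BddMeas.continuousAdd (Ω : Type*) [MeasurableSpace Ω] (𝕜 : Type*) [RCLike 𝕜] :
    ContinuousAdd (BddMeas Ω 𝕜) := IsTopologicalAddGroup.toContinuousAdd

attribute [local instance] BddMeas.continuousAdd

lemma norm_oneFun_le (Ω : Type*) [MeasurableSpace Ω] (𝕜 : Type*) [RCLike 𝕜] :
    ‖oneFun Ω 𝕜‖ ≤ 1 :=
  lp.norm_le_of_forall_le zero_le_one fun x ↦ by simp [oneFun]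

variable {S : Type*} [MeasurableSpace S] [MeasurableEq S] {P : ℕ → Kernel S S}
  [∀ t, IsMarkovKernel (P t)] (hP : MeasurableCoupling P)

lemma extZero_VhatT {𝕜 : Type*} [RCLike 𝕜] (T : ℕ) (h : BddMeas (OffDiag S) 𝕜) {x : S × S}
    (hx : x.1 ≠ x.2) :
    extZero (VhatT P 𝕜 hP T h) x = ∫ ω, integrand P T h ω ∂(etaLaw P hP x) := by
  rw [extZero, dif_pos hx]
  rfl

omit [MeasurableEq S] in
lemma extZero_of_eq {𝕜 : Type*} [RCLike 𝕜] (h : BddMeas (OffDiag S) 𝕜) {x : S × S}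
    (hx : x.1 = x.2) : extZero h x = 0 := by
  rw [extZero, dif_neg (not_not.2 hx)]

lemma extZero_VhatT_nonneg (T : ℕ) {h : BddMeas (OffDiag S) ℝ} (h0 : ∀ x, 0 ≤ extZero h x)
    (x : S × S) : 0 ≤ extZero (VhatT P ℝ hP T h) x := by
  by_cases hx : x.1 = x.2
  · rw [extZero_of_eq _ hx]
  · rw [extZero_VhatT hP T h hx]
    exact integral_nonneg fun ω ↦ mul_nonneg (weight_mem P T ω).1 (h0 _)

lemma ofReal_extZero_VhatT {T : ℕ} (hT : 1 ≤ T) {h : BddMeas (OffDiag S) ℝ}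
    (h0 : ∀ x, 0 ≤ extZero h x) (x : S × S) :
    ENNReal.ofReal (extZero (VhatT P ℝ hP T h) x) =
      iterOp P hP 0 T (fun y ↦ ENNReal.ofReal (extZero h y)) x := by
  by_cases hx : x.1 = x.2
  -- On the diagonal the left side vanishes by convention, the right side because κ = 1; the latter
  -- needs at least one step, hence `1 ≤ T`.
  · rw [extZero_of_eq _ hx, iterOp_diag hP 0 hT _ hx, ENNReal.ofReal_zero]
  · rw [extZero_VhatT hP T h hx, ofReal_integral_eq_lintegral_ofReal
      (integrable_integrand hP T h x)
      (ae_of_all _ fun ω ↦ mul_nonneg (weight_mem P T ω).1 (h0 _)),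
      ← lintegral_eweight_mul hP T (stronglyMeasurable_extZero h).measurable.ennreal_ofReal]
    refine lintegral_congr fun ω ↦ ?_
    rw [← ofReal_weight, ← ENNReal.ofReal_mul (weight_mem P T ω).1]
    rfl

omit [MeasurableEq S] in
lemma extZero_oneFun {𝕜 : Type*} [RCLike 𝕜] (x : S × S) :
    extZero (oneFun (OffDiag S) 𝕜) x = (((offDiagInd S x).toReal : ℝ) : 𝕜) := by
  by_cases hx : x.1 = x.2
  · simp [extZero_of_eq _ hx, offDiagInd, hx]
  · simp [extZero, offDiagInd, hx, oneFun]

lemma extZero_VhatT_pow_nonneg (T k : ℕ) (x : S × S) :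
    0 ≤ extZero ((VhatT P ℝ hP T ^ k) (oneFun (OffDiag S) ℝ)) x := by
  induction k generalizing x with
  | zero =>
    rw [pow_zero, one_apply_eq_self, extZero_oneFun]
    exact ENNReal.toReal_nonneg
  | succ k ih =>
    rw [pow_succ', mul_apply_eq_comp]
    exact extZero_VhatT_nonneg hP T ih x

lemma ofReal_extZero_VhatT_pow {T : ℕ} (hT : 1 ≤ T) (hper : ∀ t, P (t + T) = P t) (k : ℕ)
    (x : S × S) :
    ENNReal.ofReal (extZero ((VhatT P ℝ hP T ^ k) (oneFun (OffDiag S) ℝ)) x) =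
      iterOp P hP 0 (k * T) (offDiagInd S) x := by
  induction k generalizing x with
  | zero =>
    rw [pow_zero, one_apply_eq_self, extZero_oneFun, zero_mul, iterOp]
    exact ENNReal.ofReal_toReal (ne_top_of_le_ne_top ENNReal.one_ne_top (offDiagInd_le_one x))
  | succ k ih =>
    -- The outer factor covers times 0 to T. The inner k T steps then start at time T, and
    -- periodicity moves them back to time 0.
    rw [pow_succ', mul_apply_eq_comp,
      ofReal_extZero_VhatT hP hT (extZero_VhatT_pow_nonneg hP T k), funext ih,
      add_one_mul, add_comm (k * T), iterOp_add, iterOp_add_period hP hper]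

variable (𝕜 : Type*) [RCLike 𝕜]

set_option synthInstance.maxHeartbeats 200000 in
-- Links the real operator in `couplingRate` to the complex one, whose spectral radius enters
-- Gelfand's formula.
lemma extZero_VhatT_pow (T k : ℕ) (x : S × S) :
    extZero ((VhatT P 𝕜 hP T ^ k) (oneFun (OffDiag S) 𝕜)) x =
      ((extZero ((VhatT P ℝ hP T ^ k) (oneFun (OffDiag S) ℝ)) x : ℝ) : 𝕜) := by
  induction k generalizing x with
  | zero => simp only [pow_zero, one_apply_eq_self, extZero_oneFun, RCLike.ofReal_real_eq_id, id]
  | succ k ih =>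
    rw [pow_succ', pow_succ', mul_apply_eq_comp, mul_apply_eq_comp]
    by_cases hx : x.1 = x.2
    · rw [extZero_of_eq _ hx, extZero_of_eq _ hx, RCLike.ofReal_zero]
    · rw [extZero_VhatT hP T _ hx, extZero_VhatT hP T _ hx, ← integral_ofReal]
      refine integral_congr_ae (ae_of_all _ fun ω ↦ ?_)
      simp only [integrand, ih, RCLike.ofReal_mul, RCLike.ofReal_real_eq_id, id]

set_option synthInstance.maxHeartbeats 200000 in
lemma iterOp_le_nnnorm_VhatT_pow {T : ℕ} (hT : 1 ≤ T) (hper : ∀ t, P (t + T) = P t) (k : ℕ)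
    (x : S × S) :
    iterOp P hP 0 (k * T) (offDiagInd S) x ≤ ‖VhatT P 𝕜 hP T ^ k‖₊ := by
  rw [← ofReal_extZero_VhatT_pow hP hT hper, ← enorm_eq_nnnorm, ← ofReal_norm]
  refine ENNReal.ofReal_le_ofReal ?_
  calc extZero ((VhatT P ℝ hP T ^ k) (oneFun (OffDiag S) ℝ)) x
      ≤ ‖extZero ((VhatT P 𝕜 hP T ^ k) (oneFun (OffDiag S) 𝕜)) x‖ := by
        rw [extZero_VhatT_pow hP 𝕜, RCLike.norm_ofReal]
        exact le_abs_self _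
    _ ≤ ‖(VhatT P 𝕜 hP T ^ k) (oneFun (OffDiag S) 𝕜)‖ := norm_extZero_le _ _
    _ ≤ ‖VhatT P 𝕜 hP T ^ k‖ * ‖oneFun (OffDiag S) 𝕜‖ := ContinuousLinearMap.le_opNorm _ _
    _ ≤ ‖VhatT P 𝕜 hP T ^ k‖ := mul_le_of_le_one_right (ContinuousLinearMap.opNorm_nonneg _) (norm_oneFun_le _ _)

lemma ofReal_integral_extZero_VhatT_pow {T : ℕ} (hT : 1 ≤ T) (hper : ∀ t, P (t + T) = P t)
    (k : ℕ) (μ : Measure (S × S)) [IsFiniteMeasure μ] :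
    ENNReal.ofReal (∫ x, extZero ((VhatT P ℝ hP T ^ k) (oneFun (OffDiag S) ℝ)) x ∂μ) =
      ∫⁻ x, iterOp P hP 0 (k * T) (offDiagInd S) x ∂μ := by
  rw [ofReal_integral_eq_lintegral_ofReal
    (Integrable.of_bound (stronglyMeasurable_extZero _).aestronglyMeasurable _
      (ae_of_all _ (norm_extZero_le _)))
    (ae_of_all _ (extZero_VhatT_pow_nonneg hP T k))]
  exact lintegral_congr (ofReal_extZero_VhatT_pow hP hT hper k)

omit [MeasurableEq S] in
lemma iterOp_offDiagInd_le_div (T n : ℕ) :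
    iterOp P hP 0 n (offDiagInd S) ≤ iterOp P hP 0 (n / T * T) (offDiagInd S) := by
  conv_lhs => rw [← Nat.div_add_mod' n T, iterOp_add]
  exact iterOp_mono hP _ _ (iterOp_offDiagInd_le hP _ _)

end Powers

/-! ### Comparison of the exponential rates -/

section RateBounds

open Topology

lemma limsup_log_nnnorm_pow_div_le {A : Type*} [NormedRing A] [NormedAlgebra ℂ A]
    [CompleteSpace A] (a : A) {T : ℕ} (hT : 1 ≤ T) :
    limsup (fun n : ℕ ↦ ENNReal.log ‖a ^ (n / T)‖₊ / n) atTop ≤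
      ENNReal.log (spectralRadius ℂ a) / T := by
  have hT0 : (0 : ℝ) < T := by exact_mod_cast hT
  -- Testing against real c above the right-hand side also covers spectral radius 0, where the
  -- logarithm is -∞.
  refine EReal.le_of_forall_lt_iff_le.1 fun c hc ↦ ?_
  have hc' : ENNReal.log (spectralRadius ℂ a) < ((c * T : ℝ) : EReal) := by
    rw [EReal.div_lt_iff (by exact_mod_cast hT) (EReal.natCast_ne_top T)] at hc
    exact_mod_cast hc
  have hr : spectralRadius ℂ a < ENNReal.ofReal (Real.exp (c * T)) := by
    rw [← ENNReal.log_lt_log_iff, ENNReal.log_ofReal_of_pos (Real.exp_pos _), Real.log_exp]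
    exact hc'
  have hev : ∀ᶠ k : ℕ in atTop, ENNReal.log ‖a ^ k‖₊ ≤ ((k * (c * T) : ℝ) : EReal) := by
    -- Gelfand's formula: ‖a ^ k‖ ^ (1/k) is eventually below exp (c T), because the spectral radius
    -- is.
    filter_upwards [eventually_lt_of_limsup_lt
      ((spectrum.limsup_pow_nnnorm_pow_one_div_le_spectralRadius a).trans_lt hr),
      eventually_gt_atTop 0] with k hk hk0
    have hk0' : (0 : ℝ) < k := by exact_mod_cast hk0
    rw [one_div, ENNReal.rpow_inv_lt_iff hk0', ENNReal.rpow_natCast,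
      ← ENNReal.log_lt_log_iff, ENNReal.log_pow, ENNReal.log_ofReal_of_pos (Real.exp_pos _),
      Real.log_exp] at hk
    exact_mod_cast hk.le
  have hdiv : Tendsto (fun n : ℕ ↦ n / T) atTop atTop := Nat.tendsto_div_const_atTop (by omega)
  have hlim : Tendsto (fun n : ℕ ↦ (((n / T : ℕ) * (c * T) / n : ℝ) : EReal)) atTop (𝓝 c) := by
    refine (continuous_coe_real_ereal.tendsto _).comp ?_
    have h1 := (tendsto_nat_floor_mul_div_atTop (R := ℝ) (a := 1 / T) (by positivity)).comp
      tendsto_natCast_atTop_atTop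
    have h2 := h1.mul_const (c * T)
    rw [show 1 / (T : ℝ) * (c * T) = c by field_simp] at h2
    refine h2.congr fun n ↦ ?_
    simp only [Function.comp_apply]
    rw [one_div_mul_eq_div, Nat.floor_div_eq_div, div_mul_eq_mul_div]
  rw [← hlim.limsup_eq]
  refine limsup_le_limsup ?_
  filter_upwards [hdiv.eventually hev] with n hn
  refine (EReal.div_le_div_right_of_nonneg (by positivity) hn).trans_eq ?_
  push_cast
  rfl

lemma limsup_le_of_le_log_div_add {u v : ℕ → EReal} {c : ℝ}
    (h : ∀ᶠ n in atTop, u n ≤ ((c / n : ℝ) : EReal) + v n) :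
    limsup u atTop ≤ limsup v atTop := by
  have h0 : limsup (fun n : ℕ ↦ ((c / n : ℝ) : EReal)) atTop = 0 :=
    ((continuous_coe_real_ereal.tendsto _).comp
      (tendsto_const_div_atTop_nhds_zero_nat c)).limsup_eq
  calc limsup u atTop ≤ limsup ((fun n : ℕ ↦ ((c / n : ℝ) : EReal)) + v) atTop :=
        limsup_le_limsup h
    _ ≤ limsup (fun n : ℕ ↦ ((c / n : ℝ) : EReal)) atTop + limsup v atTop :=
        -- The first limsup is 0, hence finite, which rules out the sum of +∞ and -∞.
        EReal.limsup_add_le (by simp [h0]) (by simp [h0])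
    _ = limsup v atTop := by rw [h0, zero_add]

attribute [local instance] BddMeas.isTopologicalAddGroup BddMeas.continuousAdd

variable {S : Type*} [MeasurableSpace S] [MeasurableEq S] {P : ℕ → Kernel S S}
  [∀ t, IsMarkovKernel (P t)] (hP : MeasurableCoupling P)

lemma tvRate_le {T : ℕ} (hT : 1 ≤ T) (hper : ∀ t, P (t + T) = P t)
    (μ₁ μ₂ : ProbabilityMeasure S) (n : ℕ) :
    tvRate P μ₁ μ₂ n ≤ ((Real.log 2 / n : ℝ) : EReal) + couplingRate P hP T μ₁ μ₂ n := by
  have h2 : ENNReal.log 2 = ((Real.log 2 : ℝ) : EReal) := by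
    rw [← ENNReal.log_ofReal_of_pos two_pos, ENNReal.ofReal_ofNat]
  rw [tvRate, couplingRate, ofReal_integral_extZero_VhatT_pow hP hT hper, EReal.coe_div, ← h2]
  change _ ≤ ENNReal.log 2 / (n : EReal) + _
  rw [← EReal.add_div_of_nonneg_right (by positivity), ← ENNReal.log_mul_add]
  refine EReal.div_le_div_right_of_nonneg (by positivity) (ENNReal.log_le_log ?_)
  refine (tvDist_law_le hP _ _ n).trans ?_
  gcongr with x
  exact iterOp_offDiagInd_le_div hP T n x

set_option synthInstance.maxHeartbeats 200000 in
lemma couplingRate_le (𝕜 : Type*) [RCLike 𝕜] {T : ℕ} (hT : 1 ≤ T) (hper : ∀ t, P (t + T) = P t)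
    (μ₁ μ₂ : ProbabilityMeasure S) (n : ℕ) :
    couplingRate P hP T μ₁ μ₂ n ≤ ENNReal.log ‖VhatT P 𝕜 hP T ^ (n / T)‖₊ / n := by
  rw [couplingRate, ofReal_integral_extZero_VhatT_pow hP hT hper]
  refine EReal.div_le_div_right_of_nonneg (by positivity) (ENNReal.log_le_log ?_)
  calc _ ≤ ∫⁻ _, (‖VhatT P 𝕜 hP T ^ (n / T)‖₊ : ℝ≥0∞) ∂((μ₁ : Measure S).prod (μ₂ : Measure S)) :=
        lintegral_mono (iterOp_le_nnnorm_VhatT_pow hP 𝕜 hT hper _)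
    _ = _ := by simp

end RateBounds

end

end MarkovCoupling

theorem theorem4 {S : Type*} [MeasurableSpace S] [MeasurableEq S]
    (P : ℕ → Kernel S S) [∀ t, IsMarkovKernel (P t)]
    (hP : MarkovCoupling.MeasurableCoupling P)
    (T : ℕ) (hT : 1 ≤ T) (hper : ∀ t, P (t + T) = P t) :
    (∀ μ₁ μ₂ : ProbabilityMeasure S,
      limsup (fun n ↦ MarkovCoupling.tvRate P μ₁ μ₂ n) atTop
          ≤ limsup (fun n ↦ MarkovCoupling.couplingRate P hP T μ₁ μ₂ n) atTop ∧
      limsup (fun n ↦ MarkovCoupling.couplingRate P hP T μ₁ μ₂ n) atTop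
          ≤ ENNReal.log (spectralRadius ℂ (MarkovCoupling.VhatT P ℂ hP T)) / T) ∧
    limsup (fun n ↦ ⨆ (μ₁ : ProbabilityMeasure S) (μ₂ : ProbabilityMeasure S),
        MarkovCoupling.tvRate P μ₁ μ₂ n) atTop
      ≤ limsup (fun n ↦ ⨆ (μ₁ : ProbabilityMeasure S) (μ₂ : ProbabilityMeasure S),
        MarkovCoupling.couplingRate P hP T μ₁ μ₂ n) atTop ∧
    limsup (fun n ↦ ⨆ (μ₁ : ProbabilityMeasure S) (μ₂ : ProbabilityMeasure S),
        MarkovCoupling.couplingRate P hP T μ₁ μ₂ n) atTop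
      ≤ ENNReal.log (spectralRadius ℂ (MarkovCoupling.VhatT P ℂ hP T)) / T := by
  have hspec := MarkovCoupling.limsup_log_nnnorm_pow_div_le (MarkovCoupling.VhatT P ℂ hP T) hT
  refine ⟨fun μ₁ μ₂ ↦ ⟨?_, ?_⟩, ?_, ?_⟩
  · exact MarkovCoupling.limsup_le_of_le_log_div_add
      (.of_forall (MarkovCoupling.tvRate_le hP hT hper μ₁ μ₂))
  · exact (limsup_le_limsup
      (.of_forall (MarkovCoupling.couplingRate_le hP ℂ hT hper μ₁ μ₂))).trans hspec
  -- The error ln 2 / n does not depend on the initial laws, so the bound passes to suprema.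
  · refine MarkovCoupling.limsup_le_of_le_log_div_add (c := Real.log 2) (.of_forall fun n ↦ ?_)
    refine iSup₂_le fun μ₁ μ₂ ↦ (MarkovCoupling.tvRate_le hP hT hper μ₁ μ₂ n).trans ?_
    gcongr
    exact le_iSup₂ (f := fun μ₁ μ₂ ↦ MarkovCoupling.couplingRate P hP T μ₁ μ₂ n) μ₁ μ₂
  · refine (limsup_le_limsup (.of_forall fun n ↦ ?_)).trans hspec
    exact iSup₂_le fun μ₁ μ₂ ↦ MarkovCoupling.couplingRate_le hP ℂ hT hper μ₁ μ₂ n
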